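/- **Setting.** Let $\Omega\subset\mathbb R^3$ be a bounded domain with $\overline\Omega$ convex and $\partial\Omega\in C^{1,\alpha}$, $0<\alpha\le 1$; let $n_P$ be the exterior unit normal at $P\in\partial\Omega$, $T>0$, $Q=\overline\Omega\times[0,T]$, $\mu,\rho>0$, $\tau=1/\rho$. For the Navier–Stokes equations $\operatorname{div}u=0$, $u_t-\mu\Delta u+(u\cdot\nabla)u+\tau\,\mathrm{grad}\,p=F$ on $Q$ let $F\in C(Q)$, the initial value $A_1=u|_{t=0}\in C^2(\overline\Omega)$, and one of the following on $\partial\Omega\times[0,T]$ be given: Dirichlet data $A_3=u$ (continuous, $C^2$ in $P$ and $C^1$ in $t$), Neumann data $A_7=\partial u/\partial n\in C^1$, or Robin data $A_8=\partial u/\partial n+\sigma u\in C$ with $\sigma$ continuous, $\sigma>0$. Let also a constant $C_0\in\mathbb R$ be given. The unknown is the $33$-vector $Z=(u,\;p,u_{2x},u_{3x},\;u_y,u_z,u_{xx},u_{xy},u_{xz},u_{yy},u_{yz},u_{zz},\;\mathrm{grad}\,p)\in C(Q)$, a list of eleven blocks of three continuous functions (names only; no relation between the components is assumed), extended by $0$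 outside $Q$. Put $u_x:=(-u_{2y}-u_{3z},u_{2x},u_{3x})$, $$\psi(Z)=\big[(\mu-1)(u_{xx}+u_{yy}+u_{zz})-u_1u_x-u_2u_y-u_3u_z+F\big]I_Q,\qquad \psi_1(Z)=-\tau\,\mathrm{grad}\,p+\psi(Z).$$ **Boundary traces.** Let $h(x,t)=(2\sqrt{\pi t})^{-3}e^{-|x|^2/4t}I_{\{t>0\}}$ and $h_2(x)=1/(4\pi|x|)$. Write $h*A_1$, $h*_{\partial\Omega}A$, $h*\psi_1$ for the convolutions with $h$ over $\overline\Omega$, over $\partial\Omega\times[0,T]$ (with $dS\,d\tau$) and over $Q$; $\partial h/\partial n_{P_1}$, $\partial h/\partial n_{P_0}$ mean $\nabla h(P_0-P_1,t-\tau)\cdot n$ (gradient in the space variable of $h$) with the normal at the integration point $P_1$, respectively at the evaluation point $P_0\in\partial\Omega$. For a kernel $K$ on a set $S$ with measure $\nu$, a resolvent kernel is a $\Gamma$ with $\Gamma(y,\cdot)\in L^1(\nu)$ for all $y\in S$, such that whenever $G$ is bounded measurable and $\frac12x=G+\int Kx\,d\nu$ has a bounded measurable solution, $x=2(G+\int\Gamma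 G\,d\nu)$ is one; fix one resolvent kernel for each of the kernels below. On $S=\partial\Omega\times[0,T]$, $\nu=dS\,d\tau$, the missing one of $A_3=u$, $A_7=\partial u/\partial n$ is determined by $\frac12A=G+\int\Gamma G$, where * Dirichlet: $A=A_7$, $K=\partial h/\partial n_{P_0}$, $G=g_{02}+\frac{\partial h}{\partial n_{P_0}}*\psi_1(Z)$, and $g_{02}(P_0,t)$ is the limit, as $M\to P_0$ along $n_{P_0}$ from inside $\Omega$, of $\partial/\partial n_{P_0}$ of $h*A_1+\frac{\partial h}{\partial n_{P_1}}*_{\partial\Omega}A_3$ at $(M,t)$; * Neumann: $A=A_3$, $K=\partial h/\partial n_{P_1}$, $G=g_{04}+h*\psi_1(Z)$, and $g_{04}(P_0,t)=\lim_{M\to P_0,\,M\in\Omega}(h*A_1+h*_{\partial\Omega}A_7)(M,t)$; * Robin: $A=A_3$, $K=\partial h/\partial n_{P_1}-h\,\sigma(P_1,\tau)$, $G=g_{06}+h*\psi_1(Z)$, $g_{06}$ as $g_{04}$ with $A_8$ for $A_7$; then $A_7=A_8-\sigma A_3$. Further $A_2=\big(h*A_1+h*_{\partial\Omega}A_7+\frac{\partial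 h}{\partial n_{P_1}}*_{\partial\Omega}A_3+h*\psi_1(Z)\big)\big|_{t=T}$, and $A_{3+j}=\partial_jA_3+(A_7-\frac{\partial A_3}{\partial n})n_j$, $j=1,2,3$, where the derivatives are those of $A_3$ along $\partial\Omega$ (only their tangential part enters). **Fourier data.** For $\xi=(\xi_1,\xi_2,\xi_3,\xi_0)$, $X=(x,y,z,t)$ let $\hat f(\xi)=F(f)(\xi)=\int f(X)e^{-i\xi\cdot X}dX$, and let $F^{-1}$ be the inverse transform with factor $(2\pi)^{-4}$. Let $$f_0=\int_{\overline\Omega}(A_2e^{-iT\xi_0}-A_1)e^{-i(\xi_1x+\xi_2y+\xi_3z)},\quad f_j=\int A_3n_je^{-i\xi\cdot X},\quad f_{jk}=\int A_{3+j}n_ke^{-i\xi\cdot X},\quad g_j=\int A_9n_je^{-i\xi\cdot X},$$ the last three over $\partial\Omega\times[0,T]$ with $dS\,dt$, where the scalar $A_9$ is defined below. Let $B_1(\xi)$ ($33\times33$), $B_2$ ($33\times3$) and $\beta_1(\xi)$ be defined by the requirement that $B_1W=\beta_1+B_2v$, with $W$ named like $Z$, is the system $$i\xi_0u-u_{xx}-u_{yy}-u_{zz}+\tau\,\mathrm{grad}\,p=-f_0+v,\quad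 i\xi_1u-u_x=-f_1,\quad i\xi_2u-u_y=-f_2,\quad i\xi_3u-u_z=-f_3,$$ $$(i\xi_k)(i\xi_j)u-u_{x_kx_j}=-f_{jk}-i\xi_kf_j\ (1\le k\le j\le3),\qquad i\xi_kp-(\mathrm{grad}\,p)_k=-g_k\ (k=1,2,3),$$ the equations being taken in the order of the text, with $(k,j)=(1,1),(1,2),(1,3),(2,2),(2,3),(3,3)$. Let $\delta_\epsilon(X)=(\sqrt{\pi\epsilon})^{-4}e^{-|X|^2/\epsilon}$. Let $\psi_2(Z)$ on $\Omega\times(0,T)$ be the $p$-component of $F^{-1}\big(B_1^{-1}\beta_1+B_1^{-1}B_2\widehat{\psi(Z)}\big)$ with $A_9$ replaced by $0$ in $\beta_1$, i.e. the limit as $\epsilon\to0^+$ of the $p$-component of $F^{-1}\big(\hat\delta_\epsilon(B_1^{-1}\beta_1+B_1^{-1}B_2\widehat{\psi(Z)})\big)$; let $\psi_3(P_0,t)=\lim_{M\to P_0,\,M\in\Omega}\psi_2(M,t)$, and $$\tfrac12A_9(P_0,t)=\psi_3(P_0,t)+\int_{\partial\Omega}\Gamma_4(P_0,P_1)\psi_3(P_1,t)\,dS_{P_1}+C_0,$$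 where $\Gamma_4$ is the fixed resolvent kernel of $K(P_0,P_1)=\nabla h_2(P_0-P_1)\cdot n_{P_1}$ on $(\partial\Omega,dS)$. **Operator.** For $\epsilon>0$, $$T_{0\epsilon}(Z)=F^{-1}\big(\hat\delta_\epsilon B_1^{-1}\beta_1\big)+F^{-1}\big(\hat\delta_\epsilon B_1^{-1}B_2\big)*\psi(Z).$$ "$Z=T_{0\epsilon}(Z)$" means that the limits, derivatives and integrals defining the traces exist (the limits and the derivatives of $A_3$ for $0<t<T$, those for $g_{02},g_{04},g_{06}$ for $0<t\le T$; the traces and $\Gamma G$, $\Gamma_4\psi_3$ are integrable) and that equality holds on $Q$. For $M>0$ put $\Omega_M=\{Z\in C(Q):\|Z\|_\infty<M\}$, with $\|Z\|_\infty=\max_{1\le i\le33}\max_Q|Z_i|$, and $\|Z\|_{L^2}=\max_{1\le i\le33}\|Z_i\|_{L^2(Q)}$. **Theorem 4.3.** For every $M>0$ the following are equivalent. 1. There exist $\epsilon_k>0$ and $Z_{1\epsilon_k}\in\Omega_M$ with $Z_{1\epsilon_k}=T_{0\epsilon_k}(Z_{1\epsilon_k})$, $k\ge1$, such that $\lim_{k\to\infty}\epsilon_k=0$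 and $\lim_{k\to\infty}Z_{1\epsilon_k}$ exists almost everywhere on $Q$. 2. There exist $\eta_k>0$ and $Z_{1\eta_k}\in\Omega_M$ with $Z_{1\eta_k}=T_{0\eta_k}(Z_{1\eta_k})$, $k\ge1$, such that $\lim_{k\to\infty}\eta_k=0$ and $\lim_{k,l\to\infty}\|Z_{1\eta_k}-Z_{1\eta_l}\|_{L^2}=0$. -/

import Mathlib

open Set Filter Topology MeasureTheory

namespace NSFixedPoint

noncomputable section

/-! ### Spaces

Points of space are in `E3`, space-time points `(x, t)` and frequencies `(ξ', ξ₀)` in `R4`.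
The 33 unknowns are indexed by `Idx = Fin 11 × Fin 3`, that is, by 11 consecutive blocks of three:
`u`, `(p, ∂ₓu₂, ∂ₓu₃)`, `u_y`, `u_z`, `u_xx`, `u_xy`, `u_xz`, `u_yy`, `u_yz`, `u_zz`, `grad p`. -/

abbrev E3 := EuclideanSpace ℝ (Fin 3)

abbrev R4 := E3 × ℝ

abbrev V3 := Fin 3 → ℝ

abbrev Idx := Fin 11 × Fin 3

/-! ### The domain -/

/-- The boundary of `Ω` is of class `C^{1,α}`: near each of its points it is the graph of a
`C^{1,α}` function `f` of two of the three coordinates, with `Ω` on one side (`s = 1` or `-1`). -/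
def HasC1HolderBoundary (Ω : Set E3) (α : ℝ) : Prop :=
  ∀ P₀ ∈ frontier Ω, ∃ δ > 0, ∃ (i : Fin 3) (s : ℝ) (f : EuclideanSpace ℝ (Fin 2) → ℝ) (C : ℝ),
    (s = 1 ∨ s = -1) ∧ ContDiff ℝ 1 f ∧
    (∀ p q, ‖fderiv ℝ f p - fderiv ℝ f q‖ ≤ C * ‖p - q‖ ^ α) ∧
    ∀ P ∈ Metric.ball P₀ δ,
      (P ∈ frontier Ω ↔ s * (P i - f !₂[P (i.succAbove 0), P (i.succAbove 1)]) = 0) ∧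
      (P ∈ Ω ↔ s * (P i - f !₂[P (i.succAbove 0), P (i.succAbove 1)]) < 0)

/-- `n` is an exterior unit normal vector to `∂Ω` at `P`. -/
def IsOuterNormal (Ω : Set E3) (P n : E3) : Prop :=
  ‖n‖ = 1 ∧ ∀ ε > 0, ∀ᶠ Q in 𝓝[Ω] P, inner ℝ (Q - P) n ≤ ε * ‖Q - P‖

/-- The exterior unit normal vector `n_P` to `∂Ω` at `P`. -/
def outerNormal (Ω : Set E3) (P : E3) : E3 := Classical.epsilon (IsOuterNormal Ω P)

/-- The surface measure `dS` on `∂Ω`. -/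
def surf (Ω : Set E3) : Measure E3 := (Measure.euclideanHausdorffMeasure 2).restrict (frontier Ω)

/-- The measure `dS dτ` on `∂Ω × [0, T]`. -/
def lateral (Ω : Set E3) (T : ℝ) : Measure R4 := (surf Ω).prod (volume.restrict (Icc 0 T))

/-- The boundary condition: the prescribed Dirichlet data `A₃ = u|∂Ω`, or Neumann data
`A₇ = ∂u/∂n`, or Robin data `A₈ = ∂u/∂n + σ u`, with the regularity they are given with. -/
inductive BoundaryCondition (Ω : Set E3) (T : ℝ)
  | dirichlet (A₃ : R4 → V3) (continuousOn : ContinuousOn A₃ (frontier Ω ×ˢ Icc 0 T))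
      (smooth_space : ∀ t ∈ Icc 0 T, ∃ g : E3 → V3, ContDiff ℝ 2 g ∧
        EqOn g (fun P => A₃ (P, t)) (frontier Ω))
      (smooth_time : ∀ P ∈ frontier Ω, ContDiffOn ℝ 1 (fun t => A₃ (P, t)) (Icc 0 T))
  | neumann (A₇ : R4 → V3)
      (smooth : ∃ g : R4 → V3, ContDiff ℝ 1 g ∧ EqOn g A₇ (frontier Ω ×ˢ Icc 0 T))
  | robin (σ : R4 → ℝ) (A₈ : R4 → V3) (continuousOn_σ : ContinuousOn σ (frontier Ω ×ˢ Icc 0 T))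
      (σ_pos : ∀ X ∈ frontier Ω ×ˢ Icc 0 T, 0 < σ X)
      (continuousOn : ContinuousOn A₈ (frontier Ω ×ˢ Icc 0 T))

/-- The data of the initial-boundary value problem for the Navier-Stokes equations
`div u = 0`, `u_t - μ Δu + (u·∇)u + (1/ρ) grad p = F` on `closure Ω × [0, T]`. The real number `C₀`
is the additive constant left free by the boundary integral equation for the pressure. -/
structure Problem where
  Ω : Set E3
  isOpen : IsOpen Ω
  isConnected : IsConnected Ω
  isBounded : Bornology.IsBounded Ω
  convex_closure : Convex ℝ (closure Ω)
  α : ℝ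
  α_pos : 0 < α
  α_le : α ≤ 1
  boundary : HasC1HolderBoundary Ω α
  T : ℝ
  T_pos : 0 < T
  μ : ℝ
  μ_pos : 0 < μ
  ρ : ℝ
  ρ_pos : 0 < ρ
  F : R4 → V3
  continuousOn_F : ContinuousOn F (closure Ω ×ˢ Icc 0 T)
  A₁ : E3 → V3
  smooth_A₁ : ContDiffOn ℝ 2 A₁ (closure Ω)
  bc : BoundaryCondition Ω T
  C₀ : ℝ

/-! ### Kernels and Fredholm resolvents -/

/-- The heat kernel `h(M, t)`. -/
def heatKernel (M : E3) (t : ℝ) : ℝ :=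
  if 0 < t then ((2 * √(Real.pi * t)) ^ 3)⁻¹ * Real.exp (-‖M‖ ^ 2 / (4 * t)) else 0

/-- `∇_M h(M, t) · v`. -/
def heatGrad (M : E3) (t : ℝ) (v : E3) : ℝ := fderiv ℝ (fun N => heatKernel N t) M v

/-- The Newton kernel `h₂(M) = 1 / (4π|M|)`. -/
def newtonKernel (M : E3) : ℝ := 1 / (4 * Real.pi * ‖M‖)

/-- `∇_M h₂(M) · v`. -/
def newtonGrad (M v : E3) : ℝ := fderiv ℝ newtonKernel M v

section Fredholm

variable {Y : Type*} [MeasurableSpace Y]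

/-- `x` is a bounded measurable function on `S`. -/
def IsBddMeas (S : Set Y) (ν : Measure Y) (x : Y → ℝ) : Prop :=
  AEStronglyMeasurable x ν ∧ ∃ C, ∀ y ∈ S, |x y| ≤ C

/-- `x` is a bounded solution on `S` of the integral equation of the second kind
`x / 2 = G + ∫ K(·, y') x(y') dν(y')`. -/
def SolvesFredholm (S : Set Y) (ν : Measure Y) (K : Y → Y → ℝ) (G x : Y → ℝ) : Prop :=
  IsBddMeas S ν x ∧ ∀ y ∈ S, Integrable (fun y' => K y y' * x y') ν ∧
    x y / 2 = G y + ∫ y', K y y' * x y' ∂ν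

/-- `Γ` is a resolvent kernel: whenever `x / 2 = G + ∫ K x dν` is solvable, the function `x`
given by `x / 2 = G + ∫ Γ G dν` is a solution. -/
def IsFredholmResolvent (S : Set Y) (ν : Measure Y) (K Γ : Y → Y → ℝ) : Prop :=
  (∀ y ∈ S, Integrable (Γ y) ν) ∧
  ∀ G : Y → ℝ, IsBddMeas S ν G → (∃ x, SolvesFredholm S ν K G x) →
    SolvesFredholm S ν K G (fun y => 2 * (G y + ∫ y', Γ y y' * G y' ∂ν))

/-- A fixed choice of the resolvent kernel of `K` given by Fredholm's theory. -/
def fredholmResolvent (S : Set Y) (ν : Measure Y) (K : Y → Y → ℝ) : Y → Y → ℝ :=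
  Classical.epsilon (IsFredholmResolvent S ν K)

end Fredholm

/-! ### Fourier transforms on space-time -/

/-- `ξ · X = ξ₁ x + ξ₂ y + ξ₃ z + ξ₀ t`. -/
def pairing (ξ X : R4) : ℝ := inner ℝ ξ.1 X.1 + ξ.2 * X.2

/-- `e^{-i ξ·X}`. -/
def phase (ξ X : R4) : ℂ := Complex.exp (-(Complex.I * (pairing ξ X : ℂ)))

/-- `F(f)(ξ) = ∫ f(X) e^{-i ξ·X} dX`. -/
def fourierR4 (f : R4 → ℂ) (ξ : R4) : ℂ := ∫ X, f X * phase ξ X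

/-- `F⁻¹(g)(X) = (2π)⁻⁴ ∫ g(ξ) e^{i ξ·X} dξ`. -/
def invFourier (g : R4 → ℂ) (X : R4) : ℂ :=
  ((2 * Real.pi : ℂ) ^ 4)⁻¹ * ∫ ξ, g ξ * Complex.exp (Complex.I * (pairing ξ X : ℂ))

/-- The mollifier `δ_ε(X) = (√(πε))⁻⁴ e^{-|X|²/ε}`. -/
def mollifier (ε : ℝ) (X : R4) : ℝ :=
  ((√(Real.pi * ε)) ^ 4)⁻¹ * Real.exp (-(‖X.1‖ ^ 2 + X.2 ^ 2) / ε)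

/-- The Fourier transform of the mollifier. -/
def mollifierHat (ε : ℝ) (ξ : R4) : ℂ := fourierR4 (fun X => (mollifier ε X : ℂ)) ξ

/-! ### The symbol matrices -/

/-- `i ξ_{j+1}`, `j = 0, 1, 2`. -/
def iξ (ξ : R4) (j : Fin 3) : ℂ := Complex.I * (ξ.1 j : ℂ)

/-- The first-order blocks of the symbol matrix. -/
def F1 : Matrix (Fin 3) (Fin 3) ℂ := !![0, 0, 0; 0, -1, 0; 0, 0, -1]

def F2 : Matrix (Fin 3) (Fin 3) ℂ := !![0, 1, 0; 0, 0, 0; 0, 0, 0]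

def F3 : Matrix (Fin 3) (Fin 3) ℂ := !![0, 0, 1; 0, 0, 0; 0, 0, 0]

def F4 (ξ : R4) : Matrix (Fin 3) (Fin 3) ℂ := !![iξ ξ 0, 0, 0; iξ ξ 1, 0, 0; iξ ξ 2, 0, 0]

/-- The `11 × 11` array of `3 × 3` blocks of `B₁`, with `τ = 1/ρ`. -/
def B1blocks (τ : ℝ) (ξ : R4) : Matrix (Fin 11) (Fin 11) (Matrix (Fin 3) (Fin 3) ℂ) :=
  let d (j : Fin 3) : Matrix (Fin 3) (Fin 3) ℂ := iξ ξ j • 1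
  let dd (j k : Fin 3) : Matrix (Fin 3) (Fin 3) ℂ := (iξ ξ j * iξ ξ k) • 1
  let d₀ : Matrix (Fin 3) (Fin 3) ℂ := (Complex.I * (ξ.2 : ℂ)) • 1
  let τE : Matrix (Fin 3) (Fin 3) ℂ := (τ : ℂ) • 1
  !![d₀, 0, 0, 0, -1, 0, 0, -1, 0, -1, τE;
     d 0, F1, F2, F3, 0, 0, 0, 0, 0, 0, 0;
     d 1, 0, -1, 0, 0, 0, 0, 0, 0, 0, 0;
     d 2, 0, 0, -1, 0, 0, 0, 0, 0, 0, 0;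
     dd 0 0, 0, 0, 0, -1, 0, 0, 0, 0, 0, 0;
     dd 0 1, 0, 0, 0, 0, -1, 0, 0, 0, 0, 0;
     dd 0 2, 0, 0, 0, 0, 0, -1, 0, 0, 0, 0;
     dd 1 1, 0, 0, 0, 0, 0, 0, -1, 0, 0, 0;
     dd 1 2, 0, 0, 0, 0, 0, 0, 0, -1, 0, 0;
     dd 2 2, 0, 0, 0, 0, 0, 0, 0, 0, -1, 0;
     0, F4 ξ, 0, 0, 0, 0, 0, 0, 0, 0, -1]

/-- The `33 × 33` matrix `B₁(ξ)`. -/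
def B1 (τ : ℝ) (ξ : R4) : Matrix Idx Idx ℂ :=
  Matrix.of fun r c => B1blocks τ ξ r.1 c.1 r.2 c.2

/-- The `33 × 3` matrix `B₂`. -/
def B2 : Matrix Idx (Fin 3) ℂ := Matrix.of fun r c => if r.1 = 0 ∧ r.2 = c then 1 else 0

namespace Problem

variable (D : Problem)

/-- The space-time cylinder `closure Ω × [0, T]`. -/
def Q : Set R4 := closure D.Ω ×ˢ Icc 0 D.T

/-- The lateral boundary `∂Ω × [0, T]`. -/
def latBdry : Set R4 := frontier D.Ω ×ˢ Icc 0 D.T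

instance compactSpace_Q : CompactSpace D.Q :=
  isCompact_iff_compactSpace.mp (D.isBounded.isCompact_closure.prod isCompact_Icc)

def τ : ℝ := 1 / D.ρ

abbrev n (P : E3) : E3 := outerNormal D.Ω P

abbrev dS : Measure E3 := surf D.Ω

abbrev dSdt : Measure R4 := lateral D.Ω D.T

/-! ### The nonlinearity

`Z : R4 → Idx → ℝ` is the vector of unknowns, extended by zero outside the cylinder. -/

/-- `∂u/∂x`, with `∂u₁/∂x` expressed through `-∂u₂/∂y - ∂u₃/∂z`. -/
def ux (Z : R4 → Idx → ℝ) (X : R4) : V3 :=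
  ![-Z X (2, 1) - Z X (3, 2), Z X (1, 1), Z X (1, 2)]

/-- `ψ(Z) = (μ-1)(u_xx + u_yy + u_zz) - u₁ u_x - u₂ u_y - u₃ u_z + F` on the cylinder. -/
def ψ (Z : R4 → Idx → ℝ) (X : R4) : V3 := D.Q.indicator
  (fun X k => (D.μ - 1) * (Z X (4, k) + Z X (7, k) + Z X (9, k))
    - Z X (0, 0) * ux Z X k - Z X (0, 1) * Z X (2, k) - Z X (0, 2) * Z X (3, k) + D.F X k) X

/-- `ψ₁(Z) = -τ grad p + ψ(Z)`, the right-hand side in `u_t - Δu = ψ₁(Z)`. -/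
def ψ₁ (Z : R4 → Idx → ℝ) (X : R4) : V3 := fun k => -D.τ * Z X (10, k) + D.ψ Z X k

/-! ### Heat potentials -/

/-- `h .* A` over `closure Ω` (initial data). -/
def initPot (A : E3 → V3) (X : R4) : V3 := ∫ P in closure D.Ω, heatKernel (X.1 - P) X.2 • A P

/-- `h .* A` over `∂Ω × [0, T]` (single layer). -/
def singleLayer (A : R4 → V3) (X : R4) : V3 :=
  ∫ Y, heatKernel (X.1 - Y.1) (X.2 - Y.2) • A Y ∂D.dSdt

/-- `∂h/∂n_{P₁} .* A` over `∂Ω × [0, T]`, the normal at the integration point (double layer). -/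
def doubleLayer (A : R4 → V3) (X : R4) : V3 :=
  ∫ Y, heatGrad (X.1 - Y.1) (X.2 - Y.2) (D.n Y.1) • A Y ∂D.dSdt

/-- `h .* f` over the cylinder. -/
def volPot (f : R4 → V3) (X : R4) : V3 := ∫ Y in D.Q, heatKernel (X.1 - Y.1) (X.2 - Y.2) • f Y

/-- `∂h/∂n_{P₀} .* f` over the cylinder, at the boundary point `X = (P₀, t)`. -/
def volPotNormal (f : R4 → V3) (X : R4) : V3 :=
  ∫ Y in D.Q, heatGrad (X.1 - Y.1) (X.2 - Y.2) (D.n X.1) • f Y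

/-! ### The boundary integral equation for the velocity -/

/-- The known part of `u` before passing to the boundary: `g₀₁`, `g₀₃`, `g₀₅` respectively. -/
def knownPart : R4 → V3 :=
  match D.bc with
  | .dirichlet A₃ _ _ _ => fun X => D.initPot D.A₁ X + D.doubleLayer A₃ X
  | .neumann A₇ _ => fun X => D.initPot D.A₁ X + D.singleLayer A₇ X
  | .robin _ A₈ _ _ _ => fun X => D.initPot D.A₁ X + D.singleLayer A₈ X

/-- `L` is the boundary value at `X = (P₀, t)` of the known part: in the Dirichlet problem
the limit of its derivative along `n_{P₀}` as the point tends to `P₀` along the interior normal,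
in the Neumann and Robin problems the limit of the function from the interior. -/
def HasBoundaryValue (X : R4) (L : V3) : Prop :=
  match D.bc with
  | .dirichlet .. => Tendsto (fun s : ℝ =>
      lineDeriv ℝ (fun M => D.knownPart (M, X.2)) (X.1 - s • D.n X.1) (D.n X.1)) (𝓝[>] 0) (𝓝 L)
  | .neumann .. => Tendsto (fun M => D.knownPart (M, X.2)) (𝓝[D.Ω] X.1) (𝓝 L)
  | .robin .. => Tendsto (fun M => D.knownPart (M, X.2)) (𝓝[D.Ω] X.1) (𝓝 L)

/-- `g₀₂`, `g₀₄`, `g₀₆` respectively. -/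
def boundaryValue (X : R4) : V3 := Classical.epsilon (D.HasBoundaryValue X)

/-- The inhomogeneous term of the boundary integral equation. -/
def source (Z : R4 → Idx → ℝ) (X : R4) : V3 :=
  match D.bc with
  | .dirichlet .. => D.boundaryValue X + D.volPotNormal (D.ψ₁ Z) X
  | .neumann .. => D.boundaryValue X + D.volPot (D.ψ₁ Z) X
  | .robin .. => D.boundaryValue X + D.volPot (D.ψ₁ Z) X

/-- The kernel of the boundary integral equation. -/
def bdryKernel (X Y : R4) : ℝ :=
  match D.bc with
  | .dirichlet .. => heatGrad (X.1 - Y.1) (X.2 - Y.2) (D.n X.1)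
  | .neumann .. => heatGrad (X.1 - Y.1) (X.2 - Y.2) (D.n Y.1)
  | .robin σ _ _ _ _ => -heatKernel (X.1 - Y.1) (X.2 - Y.2) * σ Y
      + heatGrad (X.1 - Y.1) (X.2 - Y.2) (D.n Y.1)

/-- The resolvent kernel `Γ₁`, `Γ₂`, `Γ₃` respectively. -/
def Γbdry : R4 → R4 → ℝ := fredholmResolvent D.latBdry D.dSdt D.bdryKernel

/-- The unknown boundary trace: `A / 2 = G + ∫ Γ G`. -/
def solvedTrace (Z : R4 → Idx → ℝ) (X : R4) : V3 :=
  (2 : ℝ) • (D.source Z X + ∫ Y, D.Γbdry X Y • D.source Z Y ∂D.dSdt)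

/-- `A₃ = u` on `∂Ω × [0, T]`. -/
def A₃ (Z : R4 → Idx → ℝ) : R4 → V3 :=
  match D.bc with
  | .dirichlet A₃ _ _ _ => A₃
  | .neumann .. => D.solvedTrace Z
  | .robin .. => D.solvedTrace Z

/-- `A₇ = ∂u/∂n` on `∂Ω × [0, T]`. -/
def A₇ (Z : R4 → Idx → ℝ) : R4 → V3 :=
  match D.bc with
  | .dirichlet .. => D.solvedTrace Z
  | .neumann A₇ _ => A₇
  | .robin σ A₈ _ _ _ => fun X => A₈ X - σ X • D.solvedTrace Z X

/-- `A₂ = u` at `t = T`. -/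
def A₂ (Z : R4 → Idx → ℝ) (P : E3) : V3 :=
  D.initPot D.A₁ (P, D.T) + D.singleLayer (D.A₇ Z) (P, D.T) + D.doubleLayer (D.A₃ Z) (P, D.T)
    + D.volPot (D.ψ₁ Z) (P, D.T)

/-- `A₄, A₅, A₆ = u_x, u_y, u_z` on `∂Ω × [0, T]` for `j = 0, 1, 2`:
`∂_j A₃ + (A₇ - ∂A₃/∂n) n_j`. Only the tangential part of the derivative of `A₃` matters. -/
def gradTrace (Z : R4 → Idx → ℝ) (j : Fin 3) (X : R4) : V3 :=
  let L := fderivWithin ℝ (fun P => D.A₃ Z (P, X.2)) (frontier D.Ω) X.1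
  L (EuclideanSpace.single j 1) + (D.n X.1 j) • (D.A₇ Z X - L (D.n X.1))

/-! ### The right-hand side `β₁` and the mollified operator -/

/-- `∫_{∂Ω × [0, T]} a e^{-iξ·Y} dS dτ`. -/
def layerFourier (a : R4 → ℝ) (ξ : R4) : ℂ := ∫ Y, (a Y : ℂ) * phase ξ Y ∂D.dSdt

/-- `f₀ = ∫_{closure Ω} (A₂ e^{-iTξ₀} - A₁) e^{-i x·ξ'} dx`. -/
def f₀ (Z : R4 → Idx → ℝ) (ξ : R4) (k : Fin 3) : ℂ :=
  ∫ P in closure D.Ω, (D.A₂ Z P k : ℂ) * phase ξ (P, D.T) - (D.A₁ P k : ℂ) * phase ξ (P, 0)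

/-- `f_j`: the transform of `A₃ n_j`. -/
def f (Z : R4 → Idx → ℝ) (ξ : R4) (j k : Fin 3) : ℂ :=
  D.layerFourier (fun Y => D.A₃ Z Y k * D.n Y.1 j) ξ

/-- `f_{jl}`: the transform of `A_{j+3} n_l`. -/
def ff (Z : R4 → Idx → ℝ) (ξ : R4) (j l k : Fin 3) : ℂ :=
  D.layerFourier (fun Y => D.gradTrace Z j Y k * D.n Y.1 l) ξ

/-- `g_j`: the transform of `A₉ n_j`. -/
def g (A₉ : R4 → ℝ) (ξ : R4) (j : Fin 3) : ℂ := D.layerFourier (fun Y => A₉ Y * D.n Y.1 j) ξ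

/-- The vector `β₁(ξ)`, for a given pressure trace `A₉`. -/
def β₁ (Z : R4 → Idx → ℝ) (A₉ : R4 → ℝ) (ξ : R4) (r : Idx) : ℂ :=
  ![-D.f₀ Z ξ r.2,
    -D.f Z ξ 0 r.2,
    -D.f Z ξ 1 r.2,
    -D.f Z ξ 2 r.2,
    -D.ff Z ξ 0 0 r.2 - iξ ξ 0 * D.f Z ξ 0 r.2,
    -D.ff Z ξ 1 0 r.2 - iξ ξ 0 * D.f Z ξ 1 r.2,
    -D.ff Z ξ 2 0 r.2 - iξ ξ 0 * D.f Z ξ 2 r.2,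
    -D.ff Z ξ 1 1 r.2 - iξ ξ 1 * D.f Z ξ 1 r.2,
    -D.ff Z ξ 2 1 r.2 - iξ ξ 1 * D.f Z ξ 2 r.2,
    -D.ff Z ξ 2 2 r.2 - iξ ξ 2 * D.f Z ξ 2 r.2,
    -D.g A₉ ξ r.2] r.1

/-- The transform of `ψ(Z)` over the cylinder. -/
def ψHat (Z : R4 → Idx → ℝ) (ξ : R4) (k : Fin 3) : ℂ := fourierR4 (fun X => (D.ψ Z X k : ℂ)) ξ

/-! ### The boundary integral equation for the pressure -/

/-- The pressure component of `F⁻¹(δ̂_ε (B₁⁻¹ β₁ + B₁⁻¹ B₂ FI(ψ(Z))))` without the contribution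
of the pressure trace. -/
def pressureReg (Z : R4 → Idx → ℝ) (ε : ℝ) (X : R4) : ℂ :=
  invFourier (fun ξ => mollifierHat ε ξ * (((B1 D.τ ξ)⁻¹.mulVec (D.β₁ Z 0 ξ)) (1, 0)
    + ((B1 D.τ ξ)⁻¹ * B2).mulVec (D.ψHat Z ξ) (1, 0))) X

/-- `L` is the value at `X` of the inverse transform of
`(B₁⁻¹ β₁)₄ + (B₁⁻¹ B₂)₄ FI(ψ(Z))`, from which the double layer potential of `A₉` is subtracted.
That inverse transform is a tempered distribution; its value at an interior point is the limit of
its mollifications. -/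
def HasPressureValue (Z : R4 → Idx → ℝ) (X : R4) (L : ℝ) : Prop :=
  Tendsto (fun ε => D.pressureReg Z ε X) (𝓝[>] 0) (𝓝 (L : ℂ))

/-- `ψ₂`. -/
def ψ₂ (Z : R4 → Idx → ℝ) (X : R4) : ℝ := Classical.epsilon (D.HasPressureValue Z X)

/-- `L` is the limit of `ψ₂` at the boundary point `X = (P₀, t)` from the interior. -/
def HasPressureBoundaryValue (Z : R4 → Idx → ℝ) (X : R4) (L : ℝ) : Prop :=
  Tendsto (fun M => D.ψ₂ Z (M, X.2)) (𝓝[D.Ω] X.1) (𝓝 L)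

/-- `ψ₃`. -/
def ψ₃ (Z : R4 → Idx → ℝ) (X : R4) : ℝ := Classical.epsilon (D.HasPressureBoundaryValue Z X)

/-- The resolvent kernel `Γ₄` of `∂h₂(P₀ - P₁)/∂n_{P₁}` on `∂Ω`. -/
def Γpressure : E3 → E3 → ℝ :=
  fredholmResolvent (frontier D.Ω) D.dS (fun P₀ P₁ => newtonGrad (P₀ - P₁) (D.n P₁))

/-- The pressure trace `A₉ = p` on `∂Ω × [0, T]`: `A₉ / 2 = ψ₃ + ∫ Γ₄ ψ₃ + C₀`. -/
def A₉ (Z : R4 → Idx → ℝ) (X : R4) : ℝ :=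
  2 * (D.ψ₃ Z X + (∫ P, D.Γpressure X.1 P * D.ψ₃ Z (P, X.2) ∂D.dS) + D.C₀)

/-! ### The mollified operator -/

/-- `w_{1ε} = F⁻¹(δ̂_ε B₁⁻¹ β₁)`. -/
def w₁ (Z : R4 → Idx → ℝ) (ε : ℝ) (X : R4) (r : Idx) : ℂ :=
  invFourier (fun ξ => mollifierHat ε ξ * ((B1 D.τ ξ)⁻¹.mulVec (D.β₁ Z (D.A₉ Z) ξ)) r) X

/-- `w_{2ε} = F⁻¹(δ̂_ε B₁⁻¹ B₂)`. -/
def w₂ (ε : ℝ) (X : R4) : Matrix Idx (Fin 3) ℂ :=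
  Matrix.of fun r k => invFourier (fun ξ => mollifierHat ε ξ * ((B1 D.τ ξ)⁻¹ * B2) r k) X

/-- `T_{0ε}(Z) = w_{1ε} + w_{2ε} .* ψ(Z)`. -/
def T₀ε (ε : ℝ) (Z : R4 → Idx → ℝ) (X : R4) (r : Idx) : ℂ :=
  D.w₁ Z ε X r + ∫ Y, ∑ k, D.w₂ ε (X - Y) r k * (D.ψ Z Y k : ℂ)

/-- `Z` is in the domain of the operators `T_{0ε}`: the limits, derivatives and integrals through
which the boundary traces are expressed exist. -/
structure InDomain (Z : R4 → Idx → ℝ) : Prop where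
  boundaryValue : ∀ P ∈ frontier D.Ω, ∀ t ∈ Ioc 0 D.T, ∃ L, D.HasBoundaryValue (P, t) L
  integrable_solve : ∀ X ∈ D.latBdry, Integrable (fun Y => D.Γbdry X Y • D.source Z Y) D.dSdt
  integrable_A₃ : Integrable (D.A₃ Z) D.dSdt
  integrable_A₇ : Integrable (D.A₇ Z) D.dSdt
  integrable_A₂ : IntegrableOn (D.A₂ Z) (closure D.Ω)
  differentiable_A₃ : ∀ P ∈ frontier D.Ω, ∀ t ∈ Ioo 0 D.T,
    DifferentiableWithinAt ℝ (fun P' => D.A₃ Z (P', t)) (frontier D.Ω) P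
  integrable_gradTrace : ∀ j, Integrable (D.gradTrace Z j) D.dSdt
  pressureValue : ∀ P ∈ D.Ω, ∀ t ∈ Ioo 0 D.T, ∃ L, D.HasPressureValue Z (P, t) L
  pressureBoundaryValue : ∀ P ∈ frontier D.Ω, ∀ t ∈ Ioo 0 D.T,
    ∃ L, D.HasPressureBoundaryValue Z (P, t) L
  integrable_pressure : ∀ P ∈ frontier D.Ω, ∀ t ∈ Ioo 0 D.T,
    Integrable (fun P' => D.Γpressure P P' * D.ψ₃ Z (P', t)) D.dS
  integrable_A₉ : Integrable (D.A₉ Z) D.dSdt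

/-! ### Fixed points in `C(closure Ω × [0, T])` -/

/-- The extension by zero of a vector function on the cylinder. -/
def zeroExt (Z : C(D.Q, Idx → ℝ)) (X : R4) : Idx → ℝ := by
  classical exact if h : X ∈ D.Q then Z ⟨X, h⟩ else 0

/-- `Z = T_{0ε}(Z)` on the cylinder. -/
structure IsFixedPoint (ε : ℝ) (Z : C(D.Q, Idx → ℝ)) : Prop where
  inDomain : D.InDomain (D.zeroExt Z)
  eq : ∀ (X : D.Q) (r : Idx), D.T₀ε ε (D.zeroExt Z) X r = (Z X r : ℂ)

/-- `Ω_M = {Z ∈ C(closure Ω × [0, T]) : ‖Z‖_∞ < M}`; the norm is the maximum over the cylinder and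
over the 33 components. -/
def ΩM (M : ℝ) : Set C(D.Q, Idx → ℝ) := {Z | ‖Z‖ < M}

/-- The `L²` norm: the maximum over the components of their norms in `L²(closure Ω × [0, T])`. -/
def l2Norm (Z : C(D.Q, Idx → ℝ)) : ℝ :=
  Finset.univ.sup' Finset.univ_nonempty fun r : Idx => √(∫ X in D.Q, D.zeroExt Z X r ^ 2)

/-- There are `ε_k > 0` with `ε_k → 0` and fixed points `Z_k = T_{0ε_k}(Z_k)` in `Ω_M` such that
`lim Z_k` exists almost everywhere on the cylinder. -/
def HasAEConvergentFixedPoints (M : ℝ) : Prop :=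
  ∃ (ε : ℕ → ℝ) (Z : ℕ → C(D.Q, Idx → ℝ)),
    (∀ k, 0 < ε k ∧ Z k ∈ D.ΩM M ∧ D.IsFixedPoint (ε k) (Z k)) ∧
    Tendsto ε atTop (𝓝 0) ∧
    ∀ᵐ X ∂(volume.restrict D.Q), ∃ L : Idx → ℝ, Tendsto (fun k => D.zeroExt (Z k) X) atTop (𝓝 L)

end Problem

end

end NSFixedPoint

namespace NSFixedPoint

namespace Problem

variable (D : Problem)

/-! The equivalence is a fact about uniformly bounded sequences on a set of finite measure. The
fixed-point equation and the bound by `M` are conditions on each index separately, so they survive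
passing to a subsequence and the operator never has to be analysed.

From almost everywhere convergence to the Cauchy property the sequence is kept: differences are
bounded by `2M` and tend to zero almost everywhere as both indices grow, so dominated convergence on
the compact cylinder sends their squared integrals to zero (`tendsto_l2Norm_sub_of_ae_tendsto`).

Conversely, completeness of `L²` in its Riesz–Fischer form gives a subsequence with summable
distances that converges almost everywhere (`exists_subseq_ae_tendsto`); a subsequence is enough,
since the statement only asks for some sequence of parameters tending to zero. -/

lemma measurableSet_Q : MeasurableSet D.Q :=
  isClosed_closure.measurableSet.prod measurableSet_Icc

lemma isCompact_Q : IsCompact D.Q := D.isBounded.isCompact_closure.prod isCompact_Icc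

/-- Compactness gives finite volume; this is what makes constants integrable dominating functions
and bounded functions square integrable. -/
instance isFiniteMeasure_restrict_Q : IsFiniteMeasure (volume.restrict D.Q) :=
  isFiniteMeasure_restrict.mpr D.isCompact_Q.measure_lt_top.ne

lemma zeroExt_of_mem (Z : C(D.Q, Idx → ℝ)) {X : R4} (h : X ∈ D.Q) :
    D.zeroExt Z X = Z ⟨X, h⟩ := by
  simp [zeroExt, h]

lemma zeroExt_sub (Z W : C(D.Q, Idx → ℝ)) (X : R4) :
    D.zeroExt (Z - W) X = D.zeroExt Z X - D.zeroExt W X := by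
  by_cases h : X ∈ D.Q <;> simp [zeroExt, h]

/-- The extension may jump across the boundary of the cylinder, so continuity is claimed relative to
`D.Q` only; this suffices for measurability with respect to the restricted measure. -/
lemma continuousOn_zeroExt (Z : C(D.Q, Idx → ℝ)) : ContinuousOn (D.zeroExt Z) D.Q := by
  rw [continuousOn_iff_continuous_domRestrict]
  convert Z.continuous using 1
  funext X
  exact D.zeroExt_of_mem Z X.2

lemma aestronglyMeasurable_zeroExt (Z : C(D.Q, Idx → ℝ)) (r : Idx) :
    AEStronglyMeasurable (fun X => D.zeroExt Z X r) (volume.restrict D.Q) :=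
  ((continuous_apply r).comp_continuousOn (D.continuousOn_zeroExt Z)).aestronglyMeasurable
    D.measurableSet_Q

lemma abs_zeroExt_le (Z : C(D.Q, Idx → ℝ)) (X : R4) (r : Idx) : |D.zeroExt Z X r| ≤ ‖Z‖ := by
  by_cases h : X ∈ D.Q
  · rw [D.zeroExt_of_mem Z h]
    exact (norm_le_pi_norm (Z ⟨X, h⟩) r).trans (Z.norm_coe_le_norm _)
  · simp [zeroExt, h]

lemma memLp_two_zeroExt (Z : C(D.Q, Idx → ℝ)) (r : Idx) :
    MemLp (fun X => D.zeroExt Z X r) 2 (volume.restrict D.Q) :=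
  MemLp.of_bound (D.aestronglyMeasurable_zeroExt Z r) ‖Z‖
    (Eventually.of_forall fun X => D.abs_zeroExt_le Z X r)

/-- Bridge from the explicit maximum of square roots of integrals to the `eLpNorm` used by the
completeness theorem. -/
lemma eLpNorm_zeroExt_le_l2Norm (Z : C(D.Q, Idx → ℝ)) (r : Idx) :
    eLpNorm (fun X => D.zeroExt Z X r) 2 (volume.restrict D.Q) ≤ ENNReal.ofReal (D.l2Norm Z) := by
  rw [(D.memLp_two_zeroExt Z r).eLpNorm_eq_integral_rpow_norm (by norm_num) (by norm_num)]
  refine ENNReal.ofReal_le_ofReal ?_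
  have h : √(∫ X in D.Q, D.zeroExt Z X r ^ 2) ≤ D.l2Norm Z :=
    Finset.le_sup' (fun r : Idx => √(∫ X in D.Q, D.zeroExt Z X r ^ 2)) (Finset.mem_univ r)
  simpa [Real.sqrt_eq_rpow] using h

/-- A uniformly bounded sequence that converges almost everywhere is Cauchy in `L²`. -/
lemma tendsto_l2Norm_sub_of_ae_tendsto {M : ℝ} {Z : ℕ → C(D.Q, Idx → ℝ)} (hZ : ∀ k, ‖Z k‖ ≤ M)
    (h : ∀ᵐ X ∂(volume.restrict D.Q), ∃ L : Idx → ℝ,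
      Tendsto (fun k => D.zeroExt (Z k) X) atTop (𝓝 L)) :
    Tendsto (fun p : ℕ × ℕ => D.l2Norm (Z p.1 - Z p.2)) atTop (𝓝 0) := by
  have key : ∀ r : Idx, Tendsto
      (fun p : ℕ × ℕ => √(∫ X in D.Q, D.zeroExt (Z p.1 - Z p.2) X r ^ 2)) atTop (𝓝 0) := by
    intro r
    have hint : Tendsto (fun p : ℕ × ℕ => ∫ X in D.Q, D.zeroExt (Z p.1 - Z p.2) X r ^ 2) atTop
        (𝓝 (∫ _ in D.Q, (0 : ℝ))) := by
      -- Dominated convergence runs along the filter of index pairs, which is countably generated.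
      -- The dominating constant comes from the triangle inequality for two functions bounded by
      -- `M`.
      refine tendsto_integral_filter_of_dominated_convergence (fun _ => (M + M) ^ 2)
        (Eventually.of_forall fun p => (D.aestronglyMeasurable_zeroExt _ r).pow 2)
        (Eventually.of_forall fun p => Eventually.of_forall fun X => ?_)
        (integrable_const _) ?_
      · rw [norm_pow, Real.norm_eq_abs]
        gcongr
        exact (D.abs_zeroExt_le _ X r).trans
          ((norm_sub_le _ _).trans (add_le_add (hZ p.1) (hZ p.2)))
      · filter_upwards [h] with X ⟨L, hL⟩
        have hr := tendsto_pi_nhds.mp hL r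
        -- As a product filter, `atTop` on pairs sends both projections to infinity, so both terms
        -- tend to the same limit `L r` and their difference to zero.
        rw [← prod_atTop_atTop_eq]
        simpa [D.zeroExt_sub] using
          ((hr.comp tendsto_fst).sub (hr.comp (tendsto_snd (f := atTop)))).pow 2
    simpa using hint.sqrt
  -- A maximum of finitely many null families tends to the maximum of zeros.
  simpa [l2Norm] using Tendsto.finset_sup'_nhds_apply
    (Finset.univ_nonempty (α := Idx)) fun r _ => key r

/-- A sequence that is Cauchy in `L²` has a subsequence that converges almost everywhere. -/
lemma exists_subseq_ae_tendsto {Z : ℕ → C(D.Q, Idx → ℝ)}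
    (h : Tendsto (fun p : ℕ × ℕ => D.l2Norm (Z p.1 - Z p.2)) atTop (𝓝 0)) :
    ∃ φ : ℕ → ℕ, StrictMono φ ∧ ∀ᵐ X ∂(volume.restrict D.Q), ∃ L : Idx → ℝ,
      Tendsto (fun k => D.zeroExt (Z (φ k)) X) atTop (𝓝 L) := by
  -- The bound covers all pairs beyond `k`, not just consecutive terms, because the completeness
  -- theorem asks for the `N`-th bound on every pair of later terms.
  have hev : ∀ N : ℕ, ∀ᶠ k in atTop, ∀ m ≥ k, ∀ n ≥ k,
      D.l2Norm (Z m - Z n) < (1 / 2 : ℝ) ^ N := by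
    intro N
    obtain ⟨⟨a, b⟩, hab⟩ :=
      eventually_atTop.mp (h.eventually_lt_const (u := (1 / 2 : ℝ) ^ N) (by positivity))
    filter_upwards [eventually_ge_atTop (max a b)] with k hk m hm n hn
    exact hab (m, n) ⟨(le_max_left a b).trans (hk.trans hm), (le_max_right a b).trans (hk.trans hn)⟩
  obtain ⟨φ, hφ, hφN⟩ := extraction_forall_of_eventually hev
  refine ⟨φ, hφ, ?_⟩
  -- Summability of the distances is what upgrades `L²` Cauchy to almost everywhere convergence.
  have hB : ∑' i : ℕ, ENNReal.ofReal ((1 / 2 : ℝ) ^ i) ≠ ⊤ :=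
    (summable_geometric_of_lt_one (by norm_num) (by norm_num)).tsum_ofReal_ne_top
  have hr : ∀ r : Idx, ∀ᵐ X ∂(volume.restrict D.Q), ∃ l : ℝ,
      Tendsto (fun k => D.zeroExt (Z (φ k)) X r) atTop (𝓝 l) := by
    intro r
    refine Lp.ae_tendsto_of_cauchy_eLpNorm (p := 2)
      (fun k => D.aestronglyMeasurable_zeroExt (Z (φ k)) r) (by norm_num) hB ?_
    intro N n m hn hm
    have hsub : ((fun X => D.zeroExt (Z (φ n)) X r) - fun X => D.zeroExt (Z (φ m)) X r) =
        fun X => D.zeroExt (Z (φ n) - Z (φ m)) X r := by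
      funext X
      simp [D.zeroExt_sub]
    rw [hsub]
    exact (D.eLpNorm_zeroExt_le_l2Norm _ r).trans_lt <|
      (ENNReal.ofReal_lt_ofReal_iff (by positivity)).mpr
        (hφN N _ (hφ.monotone hn) _ (hφ.monotone hm))
  -- Only finitely many components occur, so their exceptional null sets have a null union and the
  -- scalar limits assemble into one vector.
  filter_upwards [ae_all_iff.mpr hr] with X hX
  choose L hL using hX
  exact ⟨L, tendsto_pi_nhds.mpr hL⟩

end Problem

end NSFixedPoint

theorem theorem4p3 (D : NSFixedPoint.Problem) (M : ℝ) (hM : 0 < M) :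
    D.HasAEConvergentFixedPoints M ↔
      ∃ (η : ℕ → ℝ) (Z : ℕ → C(D.Q, NSFixedPoint.Idx → ℝ)),
        (∀ k, 0 < η k ∧ Z k ∈ D.ΩM M ∧ D.IsFixedPoint (η k) (Z k)) ∧
        Tendsto η atTop (𝓝 0) ∧
        Tendsto (fun p : ℕ × ℕ => D.l2Norm (Z p.1 - Z p.2)) atTop (𝓝 0) := by
  constructor
  · rintro ⟨ε, Z, hZ, hε, hlim⟩
    exact ⟨ε, Z, hZ, hε,
      D.tendsto_l2Norm_sub_of_ae_tendsto (fun k => (show ‖Z k‖ < M from (hZ k).2.1).le) hlim⟩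
  · rintro ⟨η, Z, hZ, hη, hcau⟩
    obtain ⟨φ, hφ, hlim⟩ := D.exists_subseq_ae_tendsto hcau
    exact ⟨η ∘ φ, Z ∘ φ, fun k => hZ (φ k), hη.comp hφ.tendsto_atTop, hlim⟩
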